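/- Let $\mathcal S$ be a nonempty set of real $d\times d$ matrices that is closed under multiplication (a matrix semigroup). Call the complex eigenvalues of largest modulus of a matrix its leading eigenvalues. The semigroup $\mathcal S$ is called Perron if every $A\in\mathcal S$ has a leading eigenvalue that is a nonnegative real number (equivalently, the spectral radius of $A$ is an eigenvalue of $A$). It is called irreducible if no linear subspace of $\mathbb R^d$ other than $\{0\}$ and $\mathbb R^d$ is mapped into itself by all matrices of $\mathcal S$. The expansion index of a matrix is the sum of the geometric multiplicities (over $\mathbb C$) of its distinct leading eigenvalues, and the expansion index of $\mathcal S$ is the minimum of the expansion indices of its elements. If $\mathcal S$ is irreducible and Perron, then, unless the expansion index of $\mathcal S$ is at least $3$, there is a closed convex cone $K\subset\mathbb R^d$ with apex at the origin, with nonempty interior and with $K\cap(-K)=\{0\}$, such that $AK\subset K$ for every $A\in\mathcal S$. -/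

import Mathlib

open scoped Pointwise

noncomputable section

namespace PerronSemigroup

/-- A real square matrix, regarded as a linear operator on `ℂ^d`. -/
def complexEnd {d : ℕ} (A : Matrix (Fin d) (Fin d) ℝ) : Module.End ℂ (Fin d → ℂ) :=
  Matrix.toLin' (A.map (fun x : ℝ => (x : ℂ)))

/-- `μ` is a leading eigenvalue of `A`: a (complex) eigenvalue of maximal modulus. -/
def IsLeading {d : ℕ} (A : Matrix (Fin d) (Fin d) ℝ) (μ : ℂ) : Prop :=
  (complexEnd A).HasEigenvalue μ ∧ ∀ ν : ℂ, (complexEnd A).HasEigenvalue ν → ‖ν‖ ≤ ‖μ‖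

theorem finite_leading {d : ℕ} (A : Matrix (Fin d) (Fin d) ℝ) : {μ : ℂ | IsLeading A μ}.Finite :=
  (Module.End.finite_hasEigenvalue (complexEnd A)).subset fun _ h => h.1

/-- `A` has a Perron eigenvalue: a leading eigenvalue that is a nonnegative real number. -/
def HasPerronEigenvalue {d : ℕ} (A : Matrix (Fin d) (Fin d) ℝ) : Prop :=
  ∃ r : ℝ, 0 ≤ r ∧ IsLeading A (r : ℂ)

/-- The expansion index of a matrix: the sum of the geometric multiplicities of its leading
eigenvalues. -/
def expansionIndex {d : ℕ} (A : Matrix (Fin d) (Fin d) ℝ) : ℕ :=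
  ∑ μ ∈ (finite_leading A).toFinset, Module.finrank ℂ ((complexEnd A).eigenspace μ)

/-- The expansion index of a (nonempty) semigroup: the minimal expansion index of its elements. -/
def semigroupIndex {d : ℕ} (S : Subsemigroup (Matrix (Fin d) (Fin d) ℝ)) : ℕ :=
  sInf (expansionIndex '' (S : Set (Matrix (Fin d) (Fin d) ℝ)))

/-- Every element of the semigroup has a Perron eigenvalue. -/
def IsPerron {d : ℕ} (S : Subsemigroup (Matrix (Fin d) (Fin d) ℝ)) : Prop :=
  ∀ A ∈ S, HasPerronEigenvalue A

/-- The elements of the semigroup share no real invariant subspace other than `0` and `ℝ^d`. -/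
def IsIrreducible {d : ℕ} (S : Subsemigroup (Matrix (Fin d) (Fin d) ℝ)) : Prop :=
  ∀ W : Submodule ℝ (Fin d → ℝ),
    (∀ A ∈ S, ∀ x ∈ W, Matrix.mulVec A x ∈ W) → W = ⊥ ∨ W = ⊤

/-- A proper cone: a closed convex cone with apex at the origin that has nonempty interior and
contains no line. -/
structure IsProperCone {d : ℕ} (K : PointedCone ℝ (Fin d → ℝ)) : Prop where
  isClosed : IsClosed (K : Set (Fin d → ℝ))
  interior_nonempty : (interior (K : Set (Fin d → ℝ))).Nonempty
  inter_neg : (K : Set (Fin d → ℝ)) ∩ -(K : Set (Fin d → ℝ)) = {0}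

/-- `K` is invariant under every element of the semigroup. -/
def IsInvariantCone {d : ℕ} (S : Subsemigroup (Matrix (Fin d) (Fin d) ℝ))
    (K : PointedCone ℝ (Fin d → ℝ)) : Prop :=
  ∀ A ∈ S, ∀ x ∈ K, Matrix.mulVec A x ∈ K

end PerronSemigroup

end

noncomputable section

namespace PerronSemigroup

open Filter Topology

/-! The Perron property survives positive scaling and limits, so it passes to `closedHull S`. Let
`A` in `S` have least expansion index, at most 2. If its spectral radius is positive, a limit of
normalized powers of `A` is a nonzero matrix whose range lies in the sum of the leading eigenspaces,
hence of rank at most 2; a nilpotent `A` is handled by a product `A ^ k * B`.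

If the hull contains a rank-one matrix `u vᵀ`, the only possibly nonzero eigenvalue of `u vᵀ A` is
`vᵀ A u`, which the Perron property makes nonnegative. The closed cone spanned by the orbit of `u`
is thus invariant and lies in the half-space `v ≥ 0`; irreducibility gives it interior and removes
lines (`exists_invariantCone_of_vecMulVec_mem`).

If the hull contains `U * W` of rank 2 but nothing of rank one, the 2×2 compressions `W * A * U`
form a semigroup in which no normalized powers degenerate to rank one. Each compression is then a
scalar or has eigenvalues `±r` (`scalar_or_trace_eq_zero`), which forces a common eigenvector
(`exists_common_eigenvector`) and contradicts irreducibility. -/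

/-! ### Complexification, and stability of Perron eigenvalues under swapping factors, scaling and
limits -/

theorem complexEnd_apply {d : ℕ} (A : Matrix (Fin d) (Fin d) ℝ) (x : Fin d → ℂ) :
    complexEnd A x = (A.map (fun x : ℝ => (x : ℂ))).mulVec x := rfl

theorem complexEnd_apply_apply {d : ℕ} (A : Matrix (Fin d) (Fin d) ℝ) (x : Fin d → ℂ) (i : Fin d) :
    complexEnd A x i = ∑ j, (A i j : ℂ) * x j := by
  simp [complexEnd_apply, Matrix.mulVec, dotProduct]

theorem map_ofReal_mul {l m n : Type*} [Fintype m] (A : Matrix l m ℝ) (B : Matrix m n ℝ) :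
    (A * B).map (fun x : ℝ => (x : ℂ)) =
      A.map (fun x : ℝ => (x : ℂ)) * B.map (fun x : ℝ => (x : ℂ)) :=
  Matrix.map_mul (f := Complex.ofRealHom)

theorem complexEnd_mul {d : ℕ} (A B : Matrix (Fin d) (Fin d) ℝ) :
    complexEnd (A * B) = complexEnd A * complexEnd B := by
  unfold complexEnd
  rw [map_ofReal_mul, Matrix.toLin'_mul]
  rfl

theorem complexEnd_one {d : ℕ} : complexEnd (1 : Matrix (Fin d) (Fin d) ℝ) = 1 := by
  unfold complexEnd
  rw [Matrix.map_one _ (by simp) (by simp), Matrix.toLin'_one]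
  rfl

theorem complexEnd_smul {d : ℕ} (t : ℝ) (A : Matrix (Fin d) (Fin d) ℝ) :
    complexEnd (t • A) = (t : ℂ) • complexEnd A := by
  ext x i
  simp [complexEnd, Matrix.mulVec_single]

theorem complexEnd_pow {d : ℕ} (A : Matrix (Fin d) (Fin d) ℝ) (n : ℕ) :
    complexEnd (A ^ n) = complexEnd A ^ n := by
  induction n with
  | zero => simpa using complexEnd_one
  | succ n ih => rw [pow_succ, pow_succ, complexEnd_mul, ih]

theorem complexEnd_ofReal {d : ℕ} (A : Matrix (Fin d) (Fin d) ℝ) (x : Fin d → ℝ) :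
    complexEnd A (fun i => (x i : ℂ)) = fun i => ((A.mulVec x i : ℝ) : ℂ) := by
  ext i
  simp [complexEnd_apply_apply, Matrix.mulVec, dotProduct]

theorem hasPerronEigenvalue_iff {d : ℕ} {A : Matrix (Fin d) (Fin d) ℝ} :
    HasPerronEigenvalue A ↔ ∃ r : ℝ, 0 ≤ r ∧ (complexEnd A).HasEigenvalue (r : ℂ) ∧
      ∀ ν : ℂ, (complexEnd A).HasEigenvalue ν → ‖ν‖ ≤ r := by
  refine exists_congr fun r => and_congr_right fun hr => ?_
  simp [IsLeading, abs_of_nonneg hr]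

theorem hasEigenvalue_iff_exists {d : ℕ} {A : Matrix (Fin d) (Fin d) ℝ} {μ : ℂ} :
    (complexEnd A).HasEigenvalue μ ↔ ∃ x, x ≠ 0 ∧ complexEnd A x = μ • x := by
  constructor
  · intro h
    obtain ⟨x, hx⟩ := h.exists_hasEigenvector
    exact ⟨x, hx.2, hx.apply_eq_smul⟩
  · rintro ⟨x, hx, h⟩
    exact Module.End.hasEigenvalue_of_hasEigenvector
      (Module.End.hasEigenvector_iff.2 ⟨Module.End.mem_eigenspace_iff.2 h, hx⟩)

theorem hasEigenvalue_mul_comm {d n : ℕ} (X : Matrix (Fin d) (Fin n) ℝ)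
    (Y : Matrix (Fin n) (Fin d) ℝ) {μ : ℂ} (hμ : μ ≠ 0)
    (h : (complexEnd (X * Y)).HasEigenvalue μ) : (complexEnd (Y * X)).HasEigenvalue μ := by
  obtain ⟨x, hx, h⟩ := hasEigenvalue_iff_exists.1 h
  rw [complexEnd_apply, map_ofReal_mul, ← Matrix.mulVec_mulVec] at h
  refine hasEigenvalue_iff_exists.2 ⟨(Y.map (fun x : ℝ => (x : ℂ))).mulVec x, ?_, ?_⟩
  · intro h0
    rw [h0, Matrix.mulVec_zero] at h
    exact smul_ne_zero hμ hx h.symm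
  · rw [complexEnd_apply, map_ofReal_mul, ← Matrix.mulVec_mulVec, h, Matrix.mulVec_smul]

/-- The two products share their nonzero spectrum. When `r = 0`, every eigenvalue of `Y * X` is
zero, and `NeZero n` guarantees that there is one. This transfers the Perron property to
compressions of smaller size. -/
theorem HasPerronEigenvalue.mul_comm {d n : ℕ} [NeZero n] {X : Matrix (Fin d) (Fin n) ℝ}
    {Y : Matrix (Fin n) (Fin d) ℝ} (h : HasPerronEigenvalue (X * Y)) :
    HasPerronEigenvalue (Y * X) := by
  obtain ⟨r, hr, he, hle⟩ := hasPerronEigenvalue_iff.1 h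
  have key : ∀ ν : ℂ, (complexEnd (Y * X)).HasEigenvalue ν → ‖ν‖ ≤ r := by
    intro ν hν
    by_cases h0 : ν = 0
    · simpa [h0] using hr
    · exact hle ν (hasEigenvalue_mul_comm Y X h0 hν)
  refine hasPerronEigenvalue_iff.2 ⟨r, hr, ?_, key⟩
  rcases hr.eq_or_lt with h0 | h0
  · obtain ⟨μ, hμ⟩ := Module.End.exists_eigenvalue (complexEnd (Y * X))
    have := key μ hμ
    rw [← h0, norm_le_zero_iff] at this
    rwa [← h0, Complex.ofReal_zero, ← this]
  · exact hasEigenvalue_mul_comm X Y (by exact_mod_cast h0.ne') he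

theorem HasPerronEigenvalue.smul {d : ℕ} {A : Matrix (Fin d) (Fin d) ℝ}
    (h : HasPerronEigenvalue A) {t : ℝ} (ht : 0 < t) : HasPerronEigenvalue (t • A) := by
  obtain ⟨r, hr, he, hle⟩ := hasPerronEigenvalue_iff.1 h
  have ht' : (t : ℂ) ≠ 0 := by exact_mod_cast ht.ne'
  refine hasPerronEigenvalue_iff.2 ⟨t * r, by positivity, ?_, fun ν hν => ?_⟩
  · obtain ⟨x, hx, h⟩ := hasEigenvalue_iff_exists.1 he
    exact hasEigenvalue_iff_exists.2 ⟨x, hx, by simp [complexEnd_smul, h, mul_smul]⟩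
  · obtain ⟨x, hx, h⟩ := hasEigenvalue_iff_exists.1 hν
    have := hle ((t : ℂ)⁻¹ * ν) (hasEigenvalue_iff_exists.2 ⟨x, hx, by
      rw [mul_smul, ← h, complexEnd_smul, LinearMap.smul_apply, inv_smul_smul₀ ht']⟩)
    rw [norm_mul, norm_inv, Complex.norm_real, Real.norm_of_nonneg ht.le] at this
    rwa [inv_mul_le_iff₀ ht] at this

theorem hasEigenvalue_iff_det {d : ℕ} {A : Matrix (Fin d) (Fin d) ℝ} {μ : ℂ} :
    (complexEnd A).HasEigenvalue μ ↔
      (Matrix.scalar (Fin d) μ - A.map (fun x : ℝ => (x : ℂ))).det = 0 := by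
  rw [Module.End.hasEigenvalue_iff_isRoot_charpoly, complexEnd, Matrix.charpoly_toLin',
    Polynomial.IsRoot, Matrix.eval_charpoly]

theorem pow_card_le_prod_norm {s : Multiset ℂ} {c : ℝ} (hc : 0 ≤ c) {ν : ℂ}
    (h : ∀ z ∈ s, c ≤ ‖ν - z‖) : c ^ Multiset.card s ≤ ‖(s.map fun z => ν - z).prod‖ := by
  induction s using Multiset.induction_on with
  | empty => simp
  | cons a s ih =>
    rw [Multiset.card_cons, Multiset.map_cons, Multiset.prod_cons, norm_mul, pow_succ']
    exact mul_le_mul (h a (Multiset.mem_cons_self a s))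
      (ih fun z hz => h z (Multiset.mem_cons_of_mem hz)) (by positivity) (norm_nonneg _)

/-- If the spectrum of `A` lies in the disc of radius `r`, then the characteristic polynomial is
bounded below outside of this disc. -/
theorem pow_le_norm_det {d : ℕ} {A : Matrix (Fin d) (Fin d) ℝ} {r : ℝ}
    (hA : ∀ ν : ℂ, (complexEnd A).HasEigenvalue ν → ‖ν‖ ≤ r) {ν : ℂ} (hν : r ≤ ‖ν‖) :
    (‖ν‖ - r) ^ d ≤ ‖(Matrix.scalar (Fin d) ν - A.map (fun x : ℝ => (x : ℂ))).det‖ := by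
  set M := A.map (fun x : ℝ => (x : ℂ)) with hM
  have hs : M.charpoly.Splits := IsAlgClosed.splits _
  rw [← Matrix.eval_charpoly, hs.eval_eq_prod_roots_of_monic M.charpoly_monic]
  have hcard : Multiset.card M.charpoly.roots = d := by
    rw [← hs.natDegree_eq_card_roots, Matrix.charpoly_natDegree_eq_dim, Fintype.card_fin]
  conv_lhs => rw [← hcard]
  refine pow_card_le_prod_norm (sub_nonneg.2 hν) fun z hz => ?_
  have hz' : (complexEnd A).HasEigenvalue z := by
    rw [Module.End.hasEigenvalue_iff_isRoot_charpoly, complexEnd, Matrix.charpoly_toLin']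
    exact Polynomial.isRoot_of_mem_roots hz
  have := hA z hz'
  have := norm_sub_norm_le ν z
  linarith

theorem norm_eigenvalue_le {d : ℕ} {A : Matrix (Fin d) (Fin d) ℝ} {μ : ℂ}
    (h : (complexEnd A).HasEigenvalue μ) : ‖μ‖ ≤ ∑ i, ∑ j, |A i j| := by
  obtain ⟨x, hx, h⟩ := hasEigenvalue_iff_exists.1 h
  refine le_of_mul_le_mul_right ?_ (norm_pos_iff.2 hx)
  rw [← norm_smul, ← h]
  refine (pi_norm_le_iff_of_nonneg (by positivity)).2 fun i => ?_
  rw [complexEnd_apply_apply]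
  calc ‖∑ j, (A i j : ℂ) * x j‖ ≤ ∑ j, ‖(A i j : ℂ) * x j‖ := norm_sum_le _ _
    _ ≤ ∑ j, |A i j| * ‖x‖ := by
      refine Finset.sum_le_sum fun j _ => ?_
      rw [norm_mul, Complex.norm_real, Real.norm_eq_abs]
      gcongr
      exact norm_le_pi_norm x j
    _ = (∑ j, |A i j|) * ‖x‖ := by rw [Finset.sum_mul]
    _ ≤ _ := by
      refine mul_le_mul_of_nonneg_right ?_ (norm_nonneg x)
      exact Finset.single_le_sum (f := fun i => ∑ j, |A i j|) (fun i _ => by positivity)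
        (Finset.mem_univ i)

/-- The Perron eigenvalues along a convergent sequence are bounded, so a subsequence tends to some
`r₀`, a root of the limiting characteristic polynomial. A root of modulus above `r₀` is excluded by
the uniform lower bound `pow_le_norm_det`. -/
theorem isClosed_setOf_hasPerronEigenvalue {d : ℕ} :
    IsClosed {A : Matrix (Fin d) (Fin d) ℝ | HasPerronEigenvalue A} := by
  have : FirstCountableTopology (Matrix (Fin d) (Fin d) ℝ) :=
    inferInstanceAs (FirstCountableTopology (Fin d → Fin d → ℝ))
  refine IsSeqClosed.isClosed fun A B hA hAB => ?_
  choose r hr he hle using fun k => hasPerronEigenvalue_iff.1 (hA k)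
  have hsum : Continuous fun A : Matrix (Fin d) (Fin d) ℝ => ∑ i, ∑ j, |A i j| :=
    continuous_finsetSum _ fun i _ => continuous_finsetSum _ fun j _ =>
      (continuous_id.matrix_elem i j).abs
  obtain ⟨C, hC⟩ := ((hsum.tendsto B).comp hAB).bddAbove_range
  have hrC : ∀ k, r k ∈ Set.Icc 0 C := fun k => ⟨hr k, by
    have h1 := norm_eigenvalue_le (he k)
    rw [Complex.norm_real, Real.norm_of_nonneg (hr k)] at h1
    exact h1.trans (hC ⟨k, rfl⟩)⟩
  obtain ⟨r₀, hr₀, φ, hφ, hlim⟩ := isCompact_Icc.tendsto_subseq hrC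
  have hAφ := hAB.comp hφ.tendsto_atTop
  have hdet : Continuous fun p : ℂ × Matrix (Fin d) (Fin d) ℝ =>
      (Matrix.scalar (Fin d) p.1 - p.2.map (fun x : ℝ => (x : ℂ))).det := by
    have h1 : Continuous fun p : ℂ × Matrix (Fin d) (Fin d) ℝ =>
        p.2.map (fun x : ℝ => (x : ℂ)) :=
      continuous_snd.matrix_map Complex.continuous_ofReal
    have h2 : Continuous fun p : ℂ × Matrix (Fin d) (Fin d) ℝ => Matrix.scalar (Fin d) p.1 :=
      Continuous.matrix_diagonal (continuous_pi fun _ => continuous_fst)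
    exact (h2.sub h1).matrix_det
  refine hasPerronEigenvalue_iff.2 ⟨r₀, hr₀.1, ?_, fun ν hν => ?_⟩
  · rw [hasEigenvalue_iff_det]
    have h1 : Tendsto (fun k => ((r (φ k) : ℂ), A (φ k))) atTop (𝓝 ((r₀ : ℂ), B)) :=
      ((Complex.continuous_ofReal.tendsto r₀).comp hlim).prodMk_nhds hAφ
    refine tendsto_nhds_unique ((hdet.tendsto _).comp h1) ?_
    refine tendsto_const_nhds.congr fun k => ?_
    exact (hasEigenvalue_iff_det.1 (he (φ k))).symm
  · by_contra! hlt
    have h1 : Tendsto (fun k => (ν, A (φ k))) atTop (𝓝 (ν, B)) :=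
      tendsto_const_nhds.prodMk_nhds hAφ
    have h2 := ((hdet.tendsto _).comp h1).norm
    have h3 : Tendsto (fun k => (‖ν‖ - r (φ k)) ^ d) atTop (𝓝 ((‖ν‖ - r₀) ^ d)) :=
      (tendsto_const_nhds.sub hlim).pow d
    have h4 := le_of_tendsto_of_tendsto h3 h2 (by
      filter_upwards [hlim.eventually (gt_mem_nhds hlt)] with k hk
      exact pow_le_norm_det (hle (φ k)) hk.le)
    simp only [hasEigenvalue_iff_det.1 hν, norm_zero] at h4
    exact absurd h4 (not_le.2 (pow_pos (sub_pos.2 hlt) d))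

/-! ### Growth of powers on generalized eigenspaces -/

theorem tendsto_choose_div_choose {j k : ℕ} (h : j < k) :
    Tendsto (fun n : ℕ => (n.choose j : ℝ) / n.choose k) atTop (𝓝 0) := by
  have h1 : (fun n : ℕ => (n : ℝ) ^ j) =o[atTop] fun n : ℕ => (n : ℝ) ^ k :=
    (Asymptotics.isLittleO_pow_pow_atTop_of_lt h).comp_tendsto tendsto_natCast_atTop_atTop
  exact (((isTheta_choose j).trans_isLittleO h1).trans_isTheta
    (isTheta_choose k).symm).tendsto_div_nhds_zero

/-- The coefficients of the binomial expansion of `(N + l) ^ n`, divided by `n.choose k * ρ ^ n`. -/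
def binomCoeff (k : ℕ) (ρ : ℝ) (l : ℂ) (j n : ℕ) : ℂ :=
  ((n.choose k : ℂ) * (ρ : ℂ) ^ n)⁻¹ * ((n.choose j : ℂ) * l ^ (n - j))

theorem norm_binomCoeff {k : ℕ} {ρ : ℝ} (hρ : 0 < ρ) {l : ℂ} {j n : ℕ} (h : j ≤ n) :
    ‖binomCoeff k ρ l j n‖ =
      (ρ ^ j)⁻¹ * ((n.choose j : ℝ) / n.choose k * (‖l‖ / ρ) ^ (n - j)) := by
  have h1 : ρ ^ n = ρ ^ j * ρ ^ (n - j) := by rw [← pow_add, Nat.add_sub_cancel' h]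
  simp only [binomCoeff, norm_mul, norm_inv, norm_pow, Complex.norm_natCast, Complex.norm_real,
    Real.norm_of_nonneg hρ.le]
  rw [h1, div_pow]
  ring

theorem tendsto_binomCoeff_of_norm_lt {k : ℕ} {ρ : ℝ} (hρ : 0 < ρ) {l : ℂ} (hl : ‖l‖ < ρ) (j : ℕ) :
    Tendsto (binomCoeff k ρ l j) atTop (𝓝 0) := by
  -- The floor `1 / 2` keeps `q` positive, hence invertible, even when `l = 0`.
  set q := max (‖l‖ / ρ) (1 / 2) with hq
  have hq0 : 0 < q := lt_max_of_lt_right (by norm_num)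
  have hq1 : q < 1 := max_lt ((div_lt_one hρ).2 hl) (by norm_num)
  have h1 : Tendsto (fun n : ℕ => (ρ ^ j)⁻¹ * (q ^ j)⁻¹ * ((n : ℝ) ^ j * q ^ n)) atTop (𝓝 0) := by
    simpa using (tendsto_pow_const_mul_const_pow_of_abs_lt_one j
      (by rwa [abs_of_pos hq0] : |q| < 1)).const_mul ((ρ ^ j)⁻¹ * (q ^ j)⁻¹)
  refine squeeze_zero_norm' ?_ h1
  filter_upwards [eventually_ge_atTop j, eventually_ge_atTop k] with n hj hk
  rw [norm_binomCoeff hρ hj, mul_assoc]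
  refine mul_le_mul_of_nonneg_left ?_ (by positivity)
  have h2 : (1 : ℝ) ≤ n.choose k := by exact_mod_cast Nat.choose_pos hk
  have h3 : (n.choose j : ℝ) ≤ (n : ℝ) ^ j := by exact_mod_cast Nat.choose_le_pow n j
  have h4 : (‖l‖ / ρ) ^ (n - j) ≤ q ^ (n - j) := pow_le_pow_left₀ (by positivity) (le_max_left _ _) _
  calc (n.choose j : ℝ) / n.choose k * (‖l‖ / ρ) ^ (n - j)
      ≤ (n : ℝ) ^ j * q ^ (n - j) := by
        refine mul_le_mul ((div_le_self (by positivity) h2).trans h3) h4 (by positivity)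
          (by positivity)
    _ = (q ^ j)⁻¹ * ((n : ℝ) ^ j * q ^ n) := by
      rw [← Nat.add_sub_cancel' hj, pow_add q, Nat.add_sub_cancel' hj]
      field_simp

theorem tendsto_binomCoeff_of_lt {j k : ℕ} (hjk : j < k) {ρ : ℝ} (hρ : 0 < ρ) {l : ℂ}
    (hl : ‖l‖ = ρ) : Tendsto (binomCoeff k ρ l j) atTop (𝓝 0) := by
  have h1 : Tendsto (fun n : ℕ => (ρ ^ j)⁻¹ * ((n.choose j : ℝ) / n.choose k)) atTop (𝓝 0) := by
    simpa using (tendsto_choose_div_choose hjk).const_mul ((ρ ^ j)⁻¹)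
  refine squeeze_zero_norm' ?_ h1
  filter_upwards [eventually_ge_atTop j] with n hj
  rw [norm_binomCoeff hρ hj, hl, div_self hρ.ne', one_pow, mul_one]

theorem norm_binomCoeff_self {k : ℕ} {ρ : ℝ} (hρ : 0 < ρ) {l : ℂ} (hl : ‖l‖ = ρ) {n : ℕ}
    (h : k ≤ n) : ‖binomCoeff k ρ l k n‖ = (ρ ^ k)⁻¹ := by
  have : (n.choose k : ℝ) ≠ 0 := by exact_mod_cast (Nat.choose_pos h).ne'
  rw [norm_binomCoeff hρ h, hl, div_self hρ.ne', one_pow, mul_one, div_self this, mul_one]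

theorem norm_binomCoeff_self_le {k : ℕ} {ρ : ℝ} (hρ : 0 < ρ) {l : ℂ} (hl : ‖l‖ = ρ) (n : ℕ) :
    ‖binomCoeff k ρ l k n‖ ≤ (ρ ^ k)⁻¹ := by
  rcases le_or_gt k n with h | h
  · exact (norm_binomCoeff_self hρ hl h).le
  · simp [binomCoeff, Nat.choose_eq_zero_of_lt h]
    positivity

section Growth

variable {V : Type*} [NormedAddCommGroup V] [NormedSpace ℂ V] (f : Module.End ℂ V)

theorem pow_apply_eq_sum {l : ℂ} {D : ℕ} {x : V}
    (hx : ∀ j, D ≤ j → ((f - algebraMap ℂ _ l) ^ j) x = 0) (n : ℕ) :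
    (f ^ n) x = ∑ j ∈ Finset.range D,
      ((n.choose j : ℂ) * l ^ (n - j)) • ((f - algebraMap ℂ _ l) ^ j) x := by
  set N := f - algebraMap ℂ (Module.End ℂ V) l with hN
  have hf : f = N + algebraMap ℂ (Module.End ℂ V) l := by simp [hN]
  have hc : Commute N (algebraMap ℂ (Module.End ℂ V) l) := (Algebra.commutes l N).symm
  have h1 : (f ^ n) x = ∑ j ∈ Finset.range (n + 1),
      ((n.choose j : ℂ) * l ^ (n - j)) • (N ^ j) x := by
    conv_lhs => rw [hf]
    rw [hc.add_pow, LinearMap.sum_apply]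
    refine Finset.sum_congr rfl fun j _ => ?_
    rw [← map_pow, ← map_natCast (algebraMap ℂ (Module.End ℂ V)), mul_assoc, ← map_mul,
      Module.End.mul_apply, Module.algebraMap_end_apply, map_smul, mul_comm]
  rw [h1]
  rcases le_total D (n + 1) with h | h
  · symm
    refine Finset.sum_subset (Finset.range_mono h) fun j _ hj => ?_
    rw [hx j (by simpa using hj), smul_zero]
  · refine Finset.sum_subset (Finset.range_mono h) fun j _ hj => ?_
    rw [Nat.choose_eq_zero_of_lt (by simp at hj; omega)]
    simp

theorem scaled_pow_apply_eq_sum {l : ℂ} {D : ℕ} {x : V}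
    (hx : ∀ j, D ≤ j → ((f - algebraMap ℂ _ l) ^ j) x = 0) (k : ℕ) (ρ : ℝ) (n : ℕ) :
    ((n.choose k : ℂ) * (ρ : ℂ) ^ n)⁻¹ • (f ^ n) x = ∑ j ∈ Finset.range D,
      binomCoeff k ρ l j n • ((f - algebraMap ℂ _ l) ^ j) x := by
  simp only [pow_apply_eq_sum f hx n, Finset.smul_sum, smul_smul, binomCoeff]

theorem tendsto_scaled_pow_of_norm_lt {l : ℂ} {D : ℕ} {x : V}
    (hx : ∀ j, D ≤ j → ((f - algebraMap ℂ _ l) ^ j) x = 0) (k : ℕ) {ρ : ℝ} (hρ : 0 < ρ)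
    (hl : ‖l‖ < ρ) :
    Tendsto (fun n : ℕ => ((n.choose k : ℂ) * (ρ : ℂ) ^ n)⁻¹ • (f ^ n) x) atTop (𝓝 0) := by
  simp only [scaled_pow_apply_eq_sum f hx]
  rw [← Finset.sum_const_zero (s := Finset.range D)]
  refine tendsto_finsetSum _ fun j _ => ?_
  simpa using (tendsto_binomCoeff_of_norm_lt (k := k) hρ hl j).smul_const
    (((f - algebraMap ℂ _ l) ^ j) x)

/-- Only the top nilpotent term survives the normalization. Its coefficient has constant modulus but
a rotating phase, so the statement is a vanishing difference rather than a limit. -/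
theorem tendsto_scaled_pow_sub {l : ℂ} {k : ℕ} {x : V}
    (hx : ∀ j, k < j → ((f - algebraMap ℂ _ l) ^ j) x = 0) {ρ : ℝ} (hρ : 0 < ρ) (hl : ‖l‖ = ρ) :
    Tendsto (fun n : ℕ => ((n.choose k : ℂ) * (ρ : ℂ) ^ n)⁻¹ • (f ^ n) x -
      binomCoeff k ρ l k n • ((f - algebraMap ℂ _ l) ^ k) x) atTop (𝓝 0) := by
  simp only [scaled_pow_apply_eq_sum f (D := k + 1) (fun j hj => hx j hj), Finset.sum_range_succ,
    add_sub_cancel_right]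
  rw [← Finset.sum_const_zero (s := Finset.range k)]
  refine tendsto_finsetSum _ fun j hj => ?_
  simpa using (tendsto_binomCoeff_of_lt (Finset.mem_range.1 hj) hρ hl).smul_const
    (((f - algebraMap ℂ _ l) ^ j) x)

end Growth

/-! ### Leading eigenspaces and limits of normalized powers -/

/-- The sum of the eigenspaces of the leading eigenvalues. -/
def leadingSpace {d : ℕ} (A : Matrix (Fin d) (Fin d) ℝ) : Submodule ℂ (Fin d → ℂ) :=
  (finite_leading A).toFinset.sup fun μ => (complexEnd A).eigenspace μ

theorem finrank_leadingSpace_le {d : ℕ} (A : Matrix (Fin d) (Fin d) ℝ) :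
    Module.finrank ℂ (leadingSpace A) ≤ expansionIndex A := by
  unfold leadingSpace expansionIndex
  generalize (finite_leading A).toFinset = s
  induction s using Finset.induction_on with
  | empty => simp
  | insert a s ha ih =>
    rw [Finset.sup_insert, Finset.sum_insert ha]
    exact (Submodule.finrank_add_le_finrank_add_finrank _ _).trans (by gcongr)

theorem eigenspace_le_leadingSpace {d : ℕ} {A : Matrix (Fin d) (Fin d) ℝ} {μ : ℂ}
    (h : IsLeading A μ) : (complexEnd A).eigenspace μ ≤ leadingSpace A :=
  Finset.le_sup (f := fun μ => (complexEnd A).eigenspace μ) (by simpa using h)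

theorem mem_leadingSpace_of_apply_eq {d : ℕ} {A : Matrix (Fin d) (Fin d) ℝ} {μ : ℂ}
    (h : IsLeading A μ) {x : Fin d → ℂ}
    (hx : ((complexEnd A) - algebraMap ℂ _ μ) x = 0) : x ∈ leadingSpace A := by
  refine eigenspace_le_leadingSpace h (Module.End.mem_eigenspace_iff.2 ?_)
  rwa [LinearMap.sub_apply, Module.algebraMap_end_apply, sub_eq_zero] at hx

theorem pow_apply_eq_zero_of_mem_maxGenEigenspace {d : ℕ} {f : Module.End ℂ (Fin d → ℂ)} {μ : ℂ}
    {x : Fin d → ℂ} (hx : x ∈ f.maxGenEigenspace μ) {j : ℕ} (hj : d ≤ j) :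
    ((f - algebraMap ℂ _ μ) ^ j) x = 0 := by
  rw [Module.End.maxGenEigenspace_eq_genEigenspace_finrank, Module.End.mem_genEigenspace_nat,
    Module.finrank_fin_fun, LinearMap.mem_ker] at hx
  rw [← Nat.sub_add_cancel hj, pow_add, Module.End.mul_apply]
  have : (f - algebraMap ℂ _ μ) = f - μ • 1 := by rw [Algebra.algebraMap_eq_smul_one]
  rw [this, hx, map_zero]

theorem eq_top_of_maxGenEigenspace_le {d : ℕ} {f : Module.End ℂ (Fin d → ℂ)}
    {p : Submodule ℂ (Fin d → ℂ)} (hp : ∀ μ, f.HasEigenvalue μ → f.maxGenEigenspace μ ≤ p) :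
    p = ⊤ := by
  rw [← top_le_iff, ← Module.End.iSup_maxGenEigenspace_eq_top f]
  refine iSup_le fun μ => ?_
  by_cases h : f.HasEigenvalue μ
  · exact hp μ h
  · intro x hx
    have : f.eigenspace μ = ⊥ := by simpa [Module.End.hasEigenvalue_iff] using h
    have h2 := pow_apply_eq_zero_of_mem_maxGenEigenspace hx le_rfl
    have hinj : Function.Injective (f - algebraMap ℂ (Module.End ℂ (Fin d → ℂ)) μ) := by
      rw [← LinearMap.ker_eq_bot, ← this, Module.End.eigenspace_def,
        Algebra.algebraMap_eq_smul_one]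
    have hinj2 : Function.Injective ((f - algebraMap ℂ (Module.End ℂ (Fin d → ℂ)) μ) ^ d) := by
      rw [Module.End.coe_pow]
      exact hinj.iterate d
    have h3 : x = 0 := hinj2 (by rw [h2, map_zero])
    rw [h3]
    exact p.zero_mem

/-- The limit points of the normalized powers of a matrix map into the sum of its leading
eigenspaces. -/
theorem exists_mem_closure_range_le_leadingSpace {d : ℕ} {A : Matrix (Fin d) (Fin d) ℝ} {ρ : ℝ}
    (hρ : 0 < ρ) (he : (complexEnd A).HasEigenvalue (ρ : ℂ))
    (hle : ∀ ν : ℂ, (complexEnd A).HasEigenvalue ν → ‖ν‖ ≤ ρ) :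
    ∃ Q ∈ closure {B | ∃ t : ℝ, 0 < t ∧ ∃ n : ℕ, 0 < n ∧ B = t • A ^ n}, Q ≠ 0 ∧
      LinearMap.range (complexEnd Q) ≤ leadingSpace A := by
  set f := complexEnd A with hf
  have hlead : ∀ μ, f.HasEigenvalue μ → ‖μ‖ = ρ → IsLeading A μ := fun μ h1 h2 =>
    ⟨h1, fun ν hν => h2 ▸ hle ν hν⟩
  obtain ⟨v, hv⟩ := he.exists_hasEigenvector
  -- The maximum `k` of `J` is one less than the size of the largest Jordan block of modulus `ρ`;
  -- the powers of `A` grow like `n.choose k * ρ ^ n`.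
  let J : Set ℕ := {j | ∃ μ, f.HasEigenvalue μ ∧ ‖μ‖ = ρ ∧ ∃ x ∈ f.maxGenEigenspace μ,
    ((f - algebraMap ℂ _ μ) ^ j) x ≠ 0}
  have hJne : J.Nonempty := ⟨0, ρ, he, by simp [hρ.le], v,
    Module.End.eigenspace_le_maxGenEigenspace hv.1, by simpa using hv.2⟩
  have hJb : BddAbove J := ⟨d, fun j ⟨μ, _, _, x, hx, h⟩ => by
    by_contra! hlt
    exact h (pow_apply_eq_zero_of_mem_maxGenEigenspace hx hlt.le)⟩
  set k := sSup J
  obtain ⟨μ₀, hμ₀, hμ₀ρ, x₀, hx₀, hx₀ne⟩ := Nat.sSup_mem hJne hJb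
  have hkmax : ∀ μ, f.HasEigenvalue μ → ‖μ‖ = ρ → ∀ x ∈ f.maxGenEigenspace μ, ∀ j, k < j →
      ((f - algebraMap ℂ _ μ) ^ j) x = 0 := by
    intro μ h1 h2 x hx j hj
    by_contra hne
    exact absurd (le_csSup hJb ⟨μ, h1, h2, x, hx, hne⟩) (not_le.2 hj)
  let M : ℕ → Matrix (Fin d) (Fin d) ℝ := fun n => ((n.choose k : ℝ) * ρ ^ n)⁻¹ • A ^ n
  have hM : ∀ n x, complexEnd (M n) x = ((n.choose k : ℂ) * (ρ : ℂ) ^ n)⁻¹ • (f ^ n) x := by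
    intro n x
    simp [M, complexEnd_smul, complexEnd_pow, hf]
  have hbdd : ∀ x, ∃ C, ∀ n, ‖complexEnd (M n) x‖ ≤ C := by
    -- Vectors with bounded normalized orbit form a subspace, so generalized eigenvectors suffice.
    let p : Submodule ℂ (Fin d → ℂ) :=
      { carrier := {x | ∃ C, ∀ n, ‖complexEnd (M n) x‖ ≤ C}
        zero_mem' := ⟨0, by simp⟩
        add_mem' := by
          rintro x y ⟨C, hC⟩ ⟨D, hD⟩
          exact ⟨C + D, fun n => by
            rw [map_add]; exact (norm_add_le _ _).trans (add_le_add (hC n) (hD n))⟩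
        smul_mem' := by
          rintro c x ⟨C, hC⟩
          exact ⟨‖c‖ * C, fun n => by
            rw [map_smul, norm_smul]
            exact mul_le_mul_of_nonneg_left (hC n) (norm_nonneg c)⟩ }
    have hp : p = ⊤ := by
      refine eq_top_of_maxGenEigenspace_le (f := f) fun μ hμ x hx => ?_
      rcases (hle μ hμ).lt_or_eq with h | h
      · have := tendsto_scaled_pow_of_norm_lt f
          (fun j hj => pow_apply_eq_zero_of_mem_maxGenEigenspace hx hj) k hρ h
        obtain ⟨C, hC⟩ := this.norm.bddAbove_range
        exact ⟨C, fun n => by rw [hM]; exact hC ⟨n, rfl⟩⟩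
      · have := tendsto_scaled_pow_sub f (hkmax μ hμ h x hx) hρ h
        obtain ⟨C, hC⟩ := this.norm.bddAbove_range
        refine ⟨C + (ρ ^ k)⁻¹ * ‖((f - algebraMap ℂ _ μ) ^ k) x‖, fun n => ?_⟩
        rw [hM, ← sub_add_cancel (((n.choose k : ℂ) * (ρ : ℂ) ^ n)⁻¹ • (f ^ n) x)
          (binomCoeff k ρ μ k n • ((f - algebraMap ℂ _ μ) ^ k) x)]
        refine (norm_add_le _ _).trans (add_le_add (hC ⟨n, rfl⟩) ?_)
        rw [norm_smul]
        exact mul_le_mul_of_nonneg_right (norm_binomCoeff_self_le hρ h n) (norm_nonneg _)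
    intro x
    have : x ∈ p := hp ▸ Submodule.mem_top
    exact this
  choose C hC using hbdd
  have hMmem : ∀ n, M n ∈ (Set.univ.pi fun _ : Fin d => Set.univ.pi fun j : Fin d =>
      Set.Icc (-C (Pi.single j 1)) (C (Pi.single j 1)) : Set (Fin d → Fin d → ℝ)) := by
    intro n i _ j _
    refine abs_le.1 ?_
    rw [← Real.norm_eq_abs, ← Complex.norm_real]
    refine le_trans ?_ (hC (Pi.single j 1) n)
    have : ((M n i j : ℝ) : ℂ) = complexEnd (M n) (Pi.single j 1) i := by
      simp [complexEnd_apply]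
    rw [this]
    exact norm_le_pi_norm _ i
  obtain ⟨Q, -, φ, hφ, hlim⟩ := IsCompact.tendsto_subseq
    (isCompact_univ_pi fun _ => isCompact_univ_pi fun j => isCompact_Icc) hMmem
  have hlim' : ∀ x, Tendsto (fun n => complexEnd (M (φ n)) x) atTop
      (𝓝 (complexEnd (Q : Matrix (Fin d) (Fin d) ℝ) x)) := by
    intro x
    refine tendsto_pi_nhds.2 fun i => ?_
    simp only [complexEnd_apply_apply]
    refine tendsto_finsetSum _ fun j _ => Tendsto.mul_const _ ?_
    exact (Complex.continuous_ofReal.tendsto _).comp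
      ((tendsto_pi_nhds.1 ((tendsto_pi_nhds.1 hlim) i)) j)
  refine ⟨Q, ?_, ?_, ?_⟩
  · refine mem_closure_of_tendsto hlim ?_
    -- The bound `k + 1` makes the binomial coefficient positive and also excludes the zeroth power.
    filter_upwards [hφ.tendsto_atTop.eventually (eventually_ge_atTop (k + 1))] with n hn
    have : 0 < (φ n).choose k := Nat.choose_pos (by omega)
    exact ⟨_, by positivity, φ n, by omega, rfl⟩
  · rintro rfl
    have h1 := (tendsto_scaled_pow_sub f (hkmax μ₀ hμ₀ hμ₀ρ x₀ hx₀) hρ hμ₀ρ).comp hφ.tendsto_atTop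
    have h2 := hlim' x₀
    simp only [hM] at h2
    have h3 := (h2.sub h1).norm
    simp only [Function.comp_apply, sub_sub_cancel, sub_zero] at h3
    have h4 : complexEnd (0 : Matrix (Fin d) (Fin d) ℝ) x₀ = 0 := by
      ext i; simp [complexEnd_apply_apply]
    -- Although the phase rotates, the norm along the subsequence is eventually constant and
    -- nonzero, so `Q x₀ ≠ 0`.
    have h5 : Tendsto (fun n => ‖binomCoeff k ρ μ₀ k (φ n) • ((f - algebraMap ℂ _ μ₀) ^ k) x₀‖)
        atTop (𝓝 ((ρ ^ k)⁻¹ * ‖((f - algebraMap ℂ _ μ₀) ^ k) x₀‖)) := by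
      refine tendsto_const_nhds.congr' ?_
      filter_upwards [hφ.tendsto_atTop.eventually (eventually_ge_atTop k)] with n hn
      rw [norm_smul, norm_binomCoeff_self hρ hμ₀ρ hn]
    have h6 := (congrArg norm h4).symm.trans (tendsto_nhds_unique h3 h5)
    rw [norm_zero] at h6
    exact absurd h6.symm (mul_ne_zero (by positivity) (norm_ne_zero_iff.2 hx₀ne))
  · rw [LinearMap.range_eq_map, Submodule.map_le_iff_le_comap, top_le_iff]
    refine eq_top_of_maxGenEigenspace_le (f := f) fun μ hμ x hx => ?_
    rw [Submodule.mem_comap]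
    rcases (hle μ hμ).lt_or_eq with h | h
    · have h1 := (tendsto_scaled_pow_of_norm_lt f
          (fun j hj => pow_apply_eq_zero_of_mem_maxGenEigenspace hx hj) k hρ h).comp
          hφ.tendsto_atTop
      have h2 := hlim' x
      simp only [hM] at h2
      rw [tendsto_nhds_unique h2 h1]
      exact Submodule.zero_mem _
    · refine mem_leadingSpace_of_apply_eq (hlead μ hμ h) ?_
      -- `Q x` is a limit of multiples of `N ^ k x`, all killed by `N`.
      set N := f - algebraMap ℂ (Module.End ℂ (Fin d → ℂ)) μ with hN
      have hcont : Continuous N := N.continuous_of_finiteDimensional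
      have h1 := (tendsto_scaled_pow_sub f (hkmax μ hμ h x hx) hρ h).comp hφ.tendsto_atTop
      have h2 := hlim' x
      simp only [hM] at h2
      have h3 := ((hcont.tendsto _).comp (h2.sub h1))
      simp only [Function.comp_def, sub_sub_cancel, sub_zero] at h3
      refine tendsto_nhds_unique h3 (tendsto_const_nhds.congr fun n => ?_)
      rw [map_smul, ← Module.End.mul_apply, ← pow_succ', hkmax μ hμ h x hx (k + 1) k.lt_succ_self,
        smul_zero]

/-! ### Full-rank factorization -/

theorem exists_toMatrix_factorization {m n : ℕ} (Q : Matrix (Fin m) (Fin m) ℝ)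
    (b : Module.Basis (Fin n) ℝ (LinearMap.range (Matrix.toLin' Q))) :
    ∃ (U : Matrix (Fin m) (Fin n) ℝ) (W : Matrix (Fin n) (Fin m) ℝ), Q = U * W ∧
      Function.Injective U.mulVec ∧ Function.Surjective W.mulVec := by
  obtain ⟨u, hu⟩ : ∃ u : (Fin n → ℝ) →ₗ[ℝ] (Fin m → ℝ), ∀ x, u x = b.equivFun.symm x :=
    ⟨(LinearMap.range (Matrix.toLin' Q)).subtype ∘ₗ b.equivFun.symm.toLinearMap, fun _ => rfl⟩
  obtain ⟨w, hw⟩ : ∃ w : (Fin m → ℝ) →ₗ[ℝ] (Fin n → ℝ),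
      ∀ x, w x = b.equivFun ((Matrix.toLin' Q).rangeRestrict x) :=
    ⟨b.equivFun.toLinearMap ∘ₗ (Matrix.toLin' Q).rangeRestrict, fun _ => rfl⟩
  refine ⟨LinearMap.toMatrix' u, LinearMap.toMatrix' w, ?_, fun x y hxy => ?_, fun y => ?_⟩
  · rw [← LinearMap.toMatrix'_comp, ← LinearMap.toMatrix'_toLin' Q]
    congr 1
    refine LinearMap.ext fun x => ?_
    rw [LinearMap.comp_apply, hu, hw, LinearEquiv.symm_apply_apply]
    simp
  · rw [LinearMap.toMatrix'_mulVec, LinearMap.toMatrix'_mulVec, hu, hu] at hxy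
    exact b.equivFun.symm.injective (Subtype.ext hxy)
  · obtain ⟨x, hx⟩ := LinearMap.surjective_rangeRestrict (Matrix.toLin' Q) (b.equivFun.symm y)
    exact ⟨x, by rw [LinearMap.toMatrix'_mulVec, hw, hx, LinearEquiv.apply_symm_apply]⟩

/-- A real matrix whose complex range lies in the sum of the leading eigenspaces of `A` has a full
rank factorization whose inner dimension is at most the expansion index of `A`. -/
theorem exists_factorization {d : ℕ} {A Q : Matrix (Fin d) (Fin d) ℝ} (hQ : Q ≠ 0)
    (h : LinearMap.range (complexEnd Q) ≤ leadingSpace A) :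
    ∃ n, 0 < n ∧ n ≤ expansionIndex A ∧
      ∃ (U : Matrix (Fin d) (Fin n) ℝ) (W : Matrix (Fin n) (Fin d) ℝ), Q = U * W ∧
        Function.Injective U.mulVec ∧ Function.Surjective W.mulVec := by
  obtain ⟨n, ⟨b⟩⟩ : ∃ n, Nonempty (Module.Basis (Fin n) ℝ (LinearMap.range (Matrix.toLin' Q))) :=
    ⟨_, ⟨Module.finBasis ℝ _⟩⟩
  obtain ⟨U, W, hUW, hU, hW⟩ := exists_toMatrix_factorization Q b
  refine ⟨n, Nat.pos_of_ne_zero ?_, ?_, U, W, hUW, hU, hW⟩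
  · rintro rfl
    refine hQ ?_
    rw [hUW]
    ext i j
    simp [Matrix.mul_apply]
  · refine le_trans ?_ (finrank_leadingSpace_le A)
    -- A real basis of the range stays independent over `ℂ`, so the real rank is bounded by the
    -- complex dimension of the leading space.
    have hli : LinearIndependent ℂ fun j => algebraMap ℝ ℂ ∘ (b j : Fin d → ℝ) :=
      linearIndependent_algebraMap_comp_iff.2
        (b.linearIndependent.map' _ (Submodule.ker_subtype _))
    have h1 := finrank_span_eq_card hli
    rw [Fintype.card_fin] at h1
    rw [← h1]
    refine Submodule.finrank_mono (Submodule.span_le.2 ?_)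
    rintro _ ⟨j, rfl⟩
    obtain ⟨x, hx⟩ := (b j).2
    refine h ⟨fun i => (x i : ℂ), ?_⟩
    rw [complexEnd_ofReal]
    ext i
    rw [Matrix.toLin'_apply] at hx
    simp [← hx]

/-! ### The closed hull and its elements of small rank -/

/-- The closure of the set of positive multiples of the elements of a matrix semigroup. -/
def closedHull {d : ℕ} (S : Subsemigroup (Matrix (Fin d) (Fin d) ℝ)) :
    Subsemigroup (Matrix (Fin d) (Fin d) ℝ) where
  carrier := closure {B | ∃ t : ℝ, 0 < t ∧ ∃ A ∈ S, B = t • A}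
  mul_mem' := by
    intro X Y hX hY
    refine map_mem_closure₂ continuous_mul hX hY ?_
    rintro _ ⟨t, ht, A, hA, rfl⟩ _ ⟨s, hs, B, hB, rfl⟩
    exact ⟨t * s, by positivity, A * B, S.mul_mem hA hB, by
      rw [smul_mul_assoc, mul_smul_comm, smul_smul]⟩

section closedHull

variable {d : ℕ} {S : Subsemigroup (Matrix (Fin d) (Fin d) ℝ)}

theorem isClosed_closedHull : IsClosed (closedHull S : Set (Matrix (Fin d) (Fin d) ℝ)) :=
  isClosed_closure

theorem subset_closedHull {A : Matrix (Fin d) (Fin d) ℝ} (hA : A ∈ S) : A ∈ closedHull S :=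
  subset_closure ⟨1, one_pos, A, hA, (one_smul _ _).symm⟩

theorem smul_mem_closedHull {A : Matrix (Fin d) (Fin d) ℝ} (hA : A ∈ closedHull S) {t : ℝ}
    (ht : 0 < t) : t • A ∈ closedHull S := by
  refine map_mem_closure (continuous_const_smul t) hA ?_
  rintro _ ⟨s, hs, B, hB, rfl⟩
  exact ⟨t * s, by positivity, B, hB, smul_smul _ _ _⟩

theorem isPerron_closedHull (h : IsPerron S) : IsPerron (closedHull S) := by
  intro A hA
  refine closure_minimal ?_ isClosed_setOf_hasPerronEigenvalue hA
  rintro _ ⟨t, ht, B, hB, rfl⟩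
  exact (h B hB).smul ht

end closedHull

theorem pow_mem_of_pos {M : Type*} [Monoid M] {S : Subsemigroup M} {a : M} (ha : a ∈ S) {n : ℕ}
    (hn : 0 < n) : a ^ n ∈ S := by
  induction n, hn using Nat.le_induction with
  | base => simpa using ha
  | succ n _ ih => rw [pow_succ]; exact S.mul_mem ih ha

theorem eq_zero_of_complexEnd_eq_zero {d : ℕ} {A : Matrix (Fin d) (Fin d) ℝ}
    (h : complexEnd A = 0) : A = 0 := by
  ext i j
  have := congrFun (LinearMap.congr_fun h (Pi.single j 1)) i
  simpa [complexEnd_apply] using this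

theorem pow_eq_zero_of_eigenvalues_eq_zero {d : ℕ} {A : Matrix (Fin d) (Fin d) ℝ}
    (h : ∀ ν : ℂ, (complexEnd A).HasEigenvalue ν → ν = 0) : A ^ d = 0 := by
  refine eq_zero_of_complexEnd_eq_zero ?_
  rw [complexEnd_pow, ← LinearMap.ker_eq_top]
  refine eq_top_of_maxGenEigenspace_le (f := complexEnd A) fun μ hμ x hx => ?_
  have := pow_apply_eq_zero_of_mem_maxGenEigenspace hx le_rfl
  rw [h μ hμ, map_zero, sub_zero] at this
  exact this

/-- The closed hull of a semigroup contains a nonzero matrix whose rank is at most the expansion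
index of a given element. -/
theorem exists_factorization_mem_closedHull {d : ℕ} {S : Subsemigroup (Matrix (Fin d) (Fin d) ℝ)}
    {A B : Matrix (Fin d) (Fin d) ℝ} (hA : A ∈ S) (hP : HasPerronEigenvalue A) (hB : B ∈ S)
    (hB0 : B ≠ 0) :
    ∃ n, 0 < n ∧ n ≤ expansionIndex A ∧
      ∃ (U : Matrix (Fin d) (Fin n) ℝ) (W : Matrix (Fin n) (Fin d) ℝ), U * W ∈ closedHull S ∧
        Function.Injective U.mulVec ∧ Function.Surjective W.mulVec := by
  suffices ∃ Q ∈ closedHull S, Q ≠ 0 ∧ LinearMap.range (complexEnd Q) ≤ leadingSpace A by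
    obtain ⟨Q, hQ, hQ0, hr⟩ := this
    obtain ⟨n, h0, hn, U, W, rfl, hU, hW⟩ := exists_factorization hQ0 hr
    exact ⟨n, h0, hn, U, W, hQ, hU, hW⟩
  obtain ⟨r, hr, he, hle⟩ := hasPerronEigenvalue_iff.1 hP
  rcases hr.eq_or_lt with h0 | h0
  -- For spectral radius zero the powers of `A` vanish, so the last nonzero `A ^ k * B` is used
  -- instead: its range lies in the kernel of `A`, the leading eigenspace for `0`.
  · have hnil : A ^ d = 0 := pow_eq_zero_of_eigenvalues_eq_zero fun ν hν => by
      have := hle ν hν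
      rwa [← h0, norm_le_zero_iff] at this
    have hex : ∃ k, A ^ k * B = 0 := ⟨d, by rw [hnil, zero_mul]⟩
    classical
    obtain ⟨k, hk⟩ : ∃ k, Nat.find hex = k + 1 := Nat.exists_eq_succ_of_ne_zero fun h => by
      have := Nat.find_spec hex
      rw [h, pow_zero, one_mul] at this
      exact hB0 this
    have hk1 : A ^ (k + 1) * B = 0 := hk ▸ Nat.find_spec hex
    have hk0 : A ^ k * B ≠ 0 := Nat.find_min hex (by omega)
    refine ⟨A ^ k * B, subset_closedHull ?_, hk0, ?_⟩
    · rcases Nat.eq_zero_or_pos k with rfl | hpos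
      · simpa using hB
      · exact S.mul_mem (pow_mem_of_pos hA hpos) hB
    · rintro _ ⟨x, rfl⟩
      refine mem_leadingSpace_of_apply_eq (μ := 0) ⟨?_, fun ν hν => ?_⟩ ?_
      · rwa [← h0] at he
      · simpa [← h0] using hle ν hν
      · rw [map_zero, sub_zero, ← Module.End.mul_apply, ← complexEnd_mul, ← mul_assoc, ← pow_succ',
          hk1]
        ext i
        simp [complexEnd_apply_apply]
  · obtain ⟨Q, hQ, h1, h2⟩ := exists_mem_closure_range_le_leadingSpace h0 he hle
    refine ⟨Q, closure_minimal ?_ isClosed_closedHull hQ, h1, h2⟩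
    rintro _ ⟨t, ht, n, hn, rfl⟩
    exact smul_mem_closedHull (subset_closedHull (pow_mem_of_pos hA hn)) ht

/-! ### The invariant cone from a rank-one element -/

/-- The span is invariant. Were it zero, the line through `x` would be invariant, hence the whole
space, and `B` would vanish. -/
theorem orbit_span_eq_top {d : ℕ} {S : Subsemigroup (Matrix (Fin d) (Fin d) ℝ)}
    (hirr : IsIrreducible S) {B : Matrix (Fin d) (Fin d) ℝ} (hB : B ∈ S) (hB0 : B ≠ 0)
    {x : Fin d → ℝ} (hx : x ≠ 0) :
    Submodule.span ℝ {y | ∃ A ∈ S, y = A.mulVec x} = ⊤ := by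
  refine (hirr _ fun A hA y hy => ?_).resolve_left fun h => ?_
  · have : Submodule.span ℝ {y | ∃ A ∈ S, y = A.mulVec x} ≤
        (Submodule.span ℝ {y | ∃ A ∈ S, y = A.mulVec x}).comap (Matrix.toLin' A) := by
      refine Submodule.span_le.2 ?_
      rintro _ ⟨C, hC, rfl⟩
      exact Submodule.subset_span ⟨A * C, S.mul_mem hA hC, by simp⟩
    exact this hy
  · have h0 : ∀ A ∈ S, A.mulVec x = 0 := fun A hA => by
      have : A.mulVec x ∈ Submodule.span ℝ {y | ∃ A ∈ S, y = A.mulVec x} :=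
        Submodule.subset_span ⟨A, hA, rfl⟩
      rwa [h, Submodule.mem_bot] at this
    have h1 := hirr (ℝ ∙ x) fun A hA y hy => by
      obtain ⟨c, rfl⟩ := Submodule.mem_span_singleton.1 hy
      rw [Matrix.mulVec_smul, h0 A hA, smul_zero]
      exact Submodule.zero_mem _
    rcases h1 with h1 | h1
    · exact hx (Submodule.span_singleton_eq_bot.1 h1)
    · refine hB0 (Matrix.toLin'.injective (LinearMap.ext fun y => ?_))
      obtain ⟨c, rfl⟩ := Submodule.mem_span_singleton.1 (h1 ▸ Submodule.mem_top : y ∈ ℝ ∙ x)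
      simp [h0 B hB]

theorem nonneg_of_hasPerronEigenvalue_fin_one {X : Matrix (Fin 1) (Fin 1) ℝ}
    (h : HasPerronEigenvalue X) : 0 ≤ X 0 0 := by
  obtain ⟨r, hr, he, -⟩ := hasPerronEigenvalue_iff.1 h
  obtain ⟨x, hx, h⟩ := hasEigenvalue_iff_exists.1 he
  have h0 := congrFun h 0
  rw [complexEnd_apply_apply] at h0
  simp only [Fin.sum_univ_one, Fin.isValue, Pi.smul_apply, smul_eq_mul] at h0
  have hx0 : x 0 ≠ 0 := fun h => hx (by ext i; rw [Subsingleton.elim i 0, h]; rfl)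
  have : X 0 0 = r := by exact_mod_cast mul_right_cancel₀ hx0 h0
  rwa [this]

theorem HasPerronEigenvalue.dotProduct_nonneg {d : ℕ} {A : Matrix (Fin d) (Fin d) ℝ}
    {u v : Fin d → ℝ} (h : HasPerronEigenvalue (Matrix.vecMulVec u v * A)) :
    0 ≤ v ⬝ᵥ A.mulVec u := by
  rw [Matrix.vecMulVec_eq (Fin 1), Matrix.mul_assoc] at h
  have h1 := nonneg_of_hasPerronEigenvalue_fin_one h.mul_comm
  rw [Matrix.mul_assoc] at h1
  simpa [Matrix.mul_apply, dotProduct, Matrix.mulVec] using h1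

theorem interior_nonempty_of_span_eq_top {d : ℕ} {K : PointedCone ℝ (Fin d → ℝ)}
    {s : Set (Fin d → ℝ)} (hs : s ⊆ K) (h : Submodule.span ℝ s = ⊤) :
    (interior (K : Set (Fin d → ℝ))).Nonempty := by
  rw [K.convex.interior_nonempty_iff_affineSpan_eq_top,
    AffineSubspace.affineSpan_eq_top_iff_vectorSpan_eq_top_of_nonempty _ _ _ ⟨0, K.zero_mem⟩,
    ← top_le_iff, ← h, Submodule.span_le]
  intro x hx
  simpa using vsub_mem_vectorSpan ℝ (hs hx) K.zero_mem

theorem exists_invariantCone_of_vecMulVec_mem {d : ℕ}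
    {S : Subsemigroup (Matrix (Fin d) (Fin d) ℝ)} (hirr : IsIrreducible S) (hP : IsPerron S)
    {B : Matrix (Fin d) (Fin d) ℝ} (hB : B ∈ S) (hB0 : B ≠ 0) {u v : Fin d → ℝ} (hu : u ≠ 0)
    (hv : v ≠ 0) (h : Matrix.vecMulVec u v ∈ closedHull S) :
    ∃ K : PointedCone ℝ (Fin d → ℝ), IsProperCone K ∧ IsInvariantCone S K := by
  set s := {y | ∃ A ∈ S, y = A.mulVec u} with hs
  let K₀ : PointedCone ℝ (Fin d → ℝ) := PointedCone.hull ℝ s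
  have hinv₀ : ∀ A ∈ S, ∀ x ∈ K₀, A.mulVec x ∈ K₀ := by
    intro A hA
    have : K₀ ≤ K₀.comap (Matrix.toLin' A) := by
      refine Submodule.span_le.2 ?_
      rintro _ ⟨C, hC, rfl⟩
      exact Submodule.subset_span ⟨A * C, S.mul_mem hA hC, by simp⟩
    exact fun x hx => this hx
  have hsK : s ⊆ (K₀.closure : Set (Fin d → ℝ)) :=
    fun x hx => subset_closure (PointedCone.subset_hull hx)
  have hinv : IsInvariantCone S K₀.closure := fun A hA x hx =>
    map_mem_closure (Matrix.toLin' A).continuous_of_finiteDimensional hx (hinv₀ A hA)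
  have hnonneg : ∀ x ∈ K₀.closure, 0 ≤ v ⬝ᵥ x := by
    intro x hx
    have hcl : IsClosed {x : Fin d → ℝ | 0 ≤ v ⬝ᵥ x} :=
      isClosed_le continuous_const (continuous_const.dotProduct continuous_id)
    refine closure_minimal ?_ hcl hx
    intro x hx
    refine Submodule.span_induction (p := fun x _ => 0 ≤ v ⬝ᵥ x) ?_ ?_ ?_ ?_ hx
    · rintro _ ⟨A, hA, rfl⟩
      exact (isPerron_closedHull hP _
        ((closedHull S).mul_mem h (subset_closedHull hA))).dotProduct_nonneg
    · simp
    · intro x y _ _ hx hy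
      rw [dotProduct_add]
      exact add_nonneg hx hy
    · intro c x _ hx
      rw [dotProduct_smul]
      exact smul_nonneg c.2 hx
  refine ⟨K₀.closure, ⟨isClosed_closure, interior_nonempty_of_span_eq_top hsK
    (orbit_span_eq_top hirr hB hB0 hu), ?_⟩, hinv⟩
  -- The lineality space is invariant, so it is zero or everything; in the latter case the
  -- functional `v`, nonnegative on the cone, would vanish.
  rcases hirr K₀.closure.lineal fun A hA x hx => ⟨hinv A hA x hx.1, by
    simpa [Matrix.mulVec_neg] using hinv A hA (-x) hx.2⟩ with h1 | h1
  · ext x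
    have : x ∈ K₀.closure.lineal ↔ x ∈ (⊥ : Submodule ℝ (Fin d → ℝ)) := by rw [h1]
    rw [PointedCone.mem_lineal, Submodule.mem_bot] at this
    exact this
  · refine absurd ?_ hv
    refine dotProduct_eq_zero_iff.1 fun x => ?_
    have hx : x ∈ K₀.closure.lineal := h1 ▸ Submodule.mem_top
    have h2 := hnonneg x hx.1
    have h3 := hnonneg (-x) hx.2
    rw [dotProduct_neg] at h3
    linarith

theorem exists_properCone_of_subset_zero {d : ℕ} {S : Subsemigroup (Matrix (Fin d) (Fin d) ℝ)}
    (hS : ∀ A ∈ S, A = 0) :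
    ∃ K : PointedCone ℝ (Fin d → ℝ), IsProperCone K ∧ IsInvariantCone S K := by
  refine ⟨PointedCone.positive ℝ (Fin d → ℝ), ⟨?_, ?_, ?_⟩, fun A hA x _ => ?_⟩
  · exact isClosed_Ici
  · refine interior_nonempty_of_span_eq_top (s := Set.range fun i => Pi.single i 1) ?_ ?_
    · rintro _ ⟨i, rfl⟩
      exact Pi.single_nonneg.2 zero_le_one
    · have := (Pi.basisFun ℝ (Fin d)).span_eq
      convert this using 3
      ext1 i
      simp
  · ext x
    simp only [Set.mem_inter_iff, SetLike.mem_coe, PointedCone.mem_positive, Set.mem_neg,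
      Set.mem_singleton_iff]
    constructor
    · rintro ⟨h1, h2⟩
      exact le_antisymm (neg_nonneg.1 h2) h1
    · rintro rfl
      simp
  · rw [hS A hA, Matrix.zero_mulVec]
    exact Submodule.zero_mem _

/-! ### Semigroups of 2×2 matrices -/

theorem hasEigenvalue_ofReal_iff_fin_two {X : Matrix (Fin 2) (Fin 2) ℝ} {r : ℝ} :
    (complexEnd X).HasEigenvalue (r : ℂ) ↔ r ^ 2 - X.trace * r + X.det = 0 := by
  rw [hasEigenvalue_iff_det, Matrix.det_fin_two, Matrix.det_fin_two, Matrix.trace_fin_two]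
  simp only [Matrix.sub_apply, Matrix.map_apply, Matrix.scalar_apply, Matrix.diagonal_apply]
  norm_num
  norm_cast
  constructor <;> intro h <;> linarith

theorem mul_self_fin_two (X : Matrix (Fin 2) (Fin 2) ℝ) :
    X * X = X.trace • X - X.det • (1 : Matrix (Fin 2) (Fin 2) ℝ) := by
  ext i j
  fin_cases i <;> fin_cases j <;>
    simp [Matrix.mul_apply, Fin.sum_univ_two, Matrix.trace_fin_two, Matrix.det_fin_two] <;> ring

/-- Lagrange interpolation of `x ^ k` at `r` and `s`, cleared of the denominator `r - s`;
`pow_of_double_root` is the confluent form. -/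
theorem pow_of_distinct_roots {n : ℕ} {X : Matrix (Fin n) (Fin n) ℝ} {r s : ℝ}
    (h : X * X = (r + s) • X - (r * s) • (1 : Matrix (Fin n) (Fin n) ℝ)) (k : ℕ) :
    (r - s) • X ^ k = r ^ k • (X - s • 1) - s ^ k • (X - r • 1) := by
  induction k with
  | zero =>
    simp only [pow_zero, one_smul, sub_smul]
    abel
  | succ k ih =>
    rw [pow_succ, ← smul_mul_assoc, ih, sub_mul, smul_mul_assoc, smul_mul_assoc, sub_mul, sub_mul, h]
    ext i j
    simp
    ring

theorem pow_of_double_root {n : ℕ} {X : Matrix (Fin n) (Fin n) ℝ} {r : ℝ}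
    (h : X * X = (r + r) • X - (r * r) • (1 : Matrix (Fin n) (Fin n) ℝ)) (k : ℕ) :
    X ^ (k + 1) = r ^ (k + 1) • 1 + (((k : ℝ) + 1) * r ^ k) • (X - r • 1) := by
  induction k with
  | zero => simp
  | succ k ih =>
    rw [pow_succ X (k + 1), ih, add_mul, smul_mul_assoc, smul_mul_assoc, sub_mul, h]
    ext i j
    simp
    ring

/-- A `2 × 2` matrix with a Perron eigenvalue, no limit point of whose normalized powers is singular,
is a multiple of the identity or of an involution with trace zero. -/
theorem scalar_or_trace_eq_zero {X : Matrix (Fin 2) (Fin 2) ℝ} (hP : HasPerronEigenvalue X)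
    (hX : ∀ Y ∈ closure {B | ∃ t : ℝ, 0 < t ∧ ∃ n : ℕ, 0 < n ∧ B = t • X ^ n}, Y.det = 0 → Y = 0) :
    ∃ r : ℝ, 0 ≤ r ∧ (X = r • 1 ∨ X.trace = 0 ∧ X.det = -r ^ 2) := by
  obtain ⟨r, hr, he, hle⟩ := hasPerronEigenvalue_iff.1 hP
  refine ⟨r, hr, ?_⟩
  have hroot := hasEigenvalue_ofReal_iff_fin_two.1 he
  -- The second eigenvalue `s` is real because `r` and the trace are.
  obtain ⟨s, hs⟩ : ∃ s, X.trace = r + s := ⟨X.trace - r, by ring⟩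
  have hdet : X.det = r * s := by rw [hs] at hroot; linarith
  have hse : (complexEnd X).HasEigenvalue (s : ℂ) :=
    hasEigenvalue_ofReal_iff_fin_two.2 (by rw [hs, hdet]; ring)
  have hsr := hle _ hse
  rw [Complex.norm_real, Real.norm_eq_abs] at hsr
  have hCH := mul_self_fin_two X
  rw [hs, hdet] at hCH
  have hX1 : X.det = 0 → X = 0 := hX X (subset_closure ⟨1, one_pos, 1, one_pos, by simp⟩)
  have hscalar : ∀ c : ℝ, (X - c • (1 : Matrix (Fin 2) (Fin 2) ℝ)).det = c ^ 2 - X.trace * c + X.det := by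
    intro c
    simp [Matrix.det_fin_two, Matrix.trace_fin_two]
    ring
  rcases eq_or_ne s (-r) with h1 | h1
  · right
    rw [hs, hdet, h1]
    constructor <;> ring
  left
  rcases hr.eq_or_lt with h0 | h0
  · rw [hX1 (by rw [hdet, ← h0, zero_mul]), ← h0, zero_smul]
  rcases eq_or_ne s r with h2 | h2
  · subst h2
    -- With a double root the normalized powers tend to the singular matrix `X - s • 1`, which must
    -- therefore vanish.
    have hlim : Tendsto (fun k : ℕ => ((((k : ℝ) + 1) * s ^ k)⁻¹) • X ^ (k + 1)) atTop
        (𝓝 (X - s • 1)) := by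
      have h3 : Tendsto (fun k : ℕ => (s * (1 / ((k : ℝ) + 1))) • (1 : Matrix (Fin 2) (Fin 2) ℝ) +
          (X - s • 1)) atTop (𝓝 (X - s • 1)) := by
        have := ((tendsto_one_div_add_atTop_nhds_zero_nat (𝕜 := ℝ)).const_mul s).smul_const
          (1 : Matrix (Fin 2) (Fin 2) ℝ)
        simpa using this.add_const (X - s • 1)
      refine h3.congr fun k => ?_
      have hk : ((k : ℝ) + 1) * s ^ k ≠ 0 := by positivity
      rw [pow_of_double_root hCH, smul_add, smul_smul, smul_smul, inv_mul_cancel₀ hk, one_smul]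
      congr 2
      field_simp
      ring
    refine sub_eq_zero.1 (hX _ (mem_closure_of_tendsto hlim (Eventually.of_forall fun k =>
      ⟨_, by positivity, k + 1, k.succ_pos, rfl⟩)) ?_)
    rw [hscalar, hs, hdet]
    ring
  · exfalso
    have hlt : |s| < r := by
      refine lt_of_le_of_ne hsr fun h => ?_
      rcases abs_eq hr |>.1 h with h | h
      · exact h2 h
      · exact h1 h
    have hpos : 0 < r - s := by have := (abs_lt.1 hlt).2; linarith
    -- With `|s| < r` the limit `X - s • 1` is again singular, hence zero; then the trace is `2 *
    -- s`, contradicting `s ≠ r`.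
    have hlim : Tendsto (fun k : ℕ => ((r ^ (k + 1))⁻¹ * (r - s)) • X ^ (k + 1)) atTop
        (𝓝 (X - s • 1)) := by
      have h3 : Tendsto (fun k : ℕ => (X - s • 1) - ((s / r) ^ (k + 1)) • (X - r • 1)) atTop
          (𝓝 (X - s • 1)) := by
        have h4 : |s / r| < 1 := by rwa [abs_div, abs_of_pos h0, div_lt_one h0]
        have := (((tendsto_pow_atTop_nhds_zero_of_abs_lt_one h4).comp
          (tendsto_add_atTop_nat 1)).smul_const (X - r • 1)).const_sub (X - s • 1)
        simpa using this
      refine h3.congr fun k => ?_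
      rw [mul_smul, pow_of_distinct_roots hCH, smul_sub (r ^ (k + 1))⁻¹,
        inv_smul_smul₀ (by positivity), smul_smul (r ^ (k + 1))⁻¹, div_pow, div_eq_inv_mul]
    have h5 := sub_eq_zero.1 (hX _ (mem_closure_of_tendsto hlim (Eventually.of_forall fun k =>
      ⟨_, by positivity, k + 1, k.succ_pos, rfl⟩)) (by rw [hscalar, hs, hdet]; ring))
    have h6 := hs
    rw [h5] at h6
    simp at h6
    exact h2 (by linarith)

/-- A semigroup of `2 × 2` matrices that are nonnegative scalars or nonsingular multiples of
involutions with trace zero has a common eigenvector. -/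
theorem exists_common_eigenvector {T : Set (Matrix (Fin 2) (Fin 2) ℝ)}
    (hmul : ∀ X ∈ T, ∀ Y ∈ T, X * Y ∈ T) (hdet : ∀ X ∈ T, X.det = 0 → X = 0)
    (h : ∀ X ∈ T, ∃ r : ℝ, 0 ≤ r ∧ (X = r • 1 ∨ X.trace = 0 ∧ X.det = -r ^ 2)) :
    ∃ e : Fin 2 → ℝ, e ≠ 0 ∧ ∀ X ∈ T, ∃ c : ℝ, X.mulVec e = c • e := by
  by_cases hall : ∀ X ∈ T, ∃ r : ℝ, X = r • 1
  · refine ⟨1, one_ne_zero, fun X hX => ?_⟩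
    obtain ⟨r, rfl⟩ := hall X hX
    exact ⟨r, by simp [Matrix.smul_mulVec]⟩
  push Not at hall
  obtain ⟨X, hX, hXs⟩ := hall
  obtain ⟨r, hr, hXr⟩ := h X hX
  obtain ⟨htX, hdX⟩ := hXr.resolve_left (hXs r)
  have hr0 : r ≠ 0 := by
    rintro rfl
    exact hXs 0 (by rw [zero_smul]; exact hdet X hX (by rw [hdX]; ring))
  have hXX : X * X = r ^ 2 • (1 : Matrix (Fin 2) (Fin 2) ℝ) := by
    rw [mul_self_fin_two, htX, hdX, zero_smul, zero_sub, neg_smul, neg_neg]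
  obtain ⟨e, he, hXe⟩ := Matrix.exists_mulVec_eq_zero_iff.2
    (show (X - r • (1 : Matrix (Fin 2) (Fin 2) ℝ)).det = 0 by
      rw [Matrix.trace_fin_two] at htX
      rw [Matrix.det_fin_two] at hdX ⊢
      simp
      linear_combination hdX - r * htX)
  rw [Matrix.sub_mulVec, Matrix.smul_mulVec, Matrix.one_mulVec, sub_eq_zero] at hXe
  refine ⟨e, he, fun Y hY => ?_⟩
  obtain ⟨q, hq, hYq⟩ := h Y hY
  rcases hYq with rfl | ⟨htY, hdY⟩
  · exact ⟨q, by simp [Matrix.smul_mulVec]⟩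
  -- If `X * Y` is a scalar, then `Y` is a multiple of `X` because `X * X = r ^ 2 • 1`. Otherwise
  -- its determinant is both `-p ^ 2` and `r ^ 2 * q ^ 2`, which forces `q = 0` and `Y = 0`.
  obtain ⟨p, hp, hXY⟩ := h _ (hmul X hX Y hY)
  rcases hXY with hXY | ⟨htXY, hdXY⟩
  · refine ⟨(r ^ 2)⁻¹ * (p * r), ?_⟩
    have h1 : X * (X * Y) = r ^ 2 • Y := by rw [← mul_assoc, hXX, smul_mul_assoc, one_mul]
    have h2 : Y = (r ^ 2)⁻¹ • (p • X) := by
      rw [hXY, mul_smul_comm, mul_one] at h1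
      rw [h1, inv_smul_smul₀ (by positivity)]
    rw [h2, Matrix.smul_mulVec, Matrix.smul_mulVec, hXe, smul_smul, smul_smul, mul_assoc]
  · have h1 : -p ^ 2 = r ^ 2 * q ^ 2 := by
      rw [← hdXY, Matrix.det_mul, hdX, hdY]
      ring
    have hq0 : q = 0 := by
      have : 0 < r ^ 2 := by positivity
      have h2 : q ^ 2 ≤ 0 := by nlinarith [sq_nonneg p, sq_nonneg q]
      exact pow_eq_zero_iff two_ne_zero |>.1 (le_antisymm h2 (sq_nonneg q))
    have hY0 : Y = 0 := hdet Y hY (by rw [hdY, hq0]; ring)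
    exact ⟨0, by simp [hY0]⟩

theorem exists_eq_vecMulVec_of_det_eq_zero {Y : Matrix (Fin 2) (Fin 2) ℝ} (h : Y.det = 0)
    (hY : Y ≠ 0) : ∃ a b : Fin 2 → ℝ, a ≠ 0 ∧ b ≠ 0 ∧ Y = Matrix.vecMulVec a b := by
  obtain ⟨i, j, hij⟩ : ∃ i j, Y i j ≠ 0 := by
    by_contra! hc
    exact hY (by ext i j; exact hc i j)
  refine ⟨fun k => Y k j / Y i j, Y i, fun h0 => ?_, fun h0 => hij (congrFun h0 j), ?_⟩
  · have := congrFun h0 i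
    simp [hij] at this
  · rw [Matrix.det_fin_two] at h
    ext k l
    rw [Matrix.vecMulVec_apply]
    field_simp
    fin_cases i <;> fin_cases j <;> fin_cases k <;> fin_cases l <;> simp <;> linarith

/-! ### From rank two to rank one, and the conclusion -/

theorem exists_vecMulVec_mem_of_factorization_two {d : ℕ}
    {S : Subsemigroup (Matrix (Fin d) (Fin d) ℝ)} (hirr : IsIrreducible S) (hP : IsPerron S)
    {B : Matrix (Fin d) (Fin d) ℝ} (hB : B ∈ S) (hB0 : B ≠ 0)
    {U : Matrix (Fin d) (Fin 2) ℝ} {W : Matrix (Fin 2) (Fin d) ℝ} (h : U * W ∈ closedHull S)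
    (hU : Function.Injective U.mulVec) (hW : Function.Surjective W.mulVec) :
    ∃ u v : Fin d → ℝ, u ≠ 0 ∧ v ≠ 0 ∧ Matrix.vecMulVec u v ∈ closedHull S := by
  by_contra! hno
  have hUne : ∀ x, x ≠ 0 → U.mulVec x ≠ 0 := fun x hx h0 =>
    hx (hU (by rw [h0, Matrix.mulVec_zero]))
  have hsing : ∀ Y : Matrix (Fin 2) (Fin 2) ℝ, U * Y * W ∈ closedHull S → Y.det = 0 → Y = 0 := by
    intro Y hY hd
    by_contra hY0
    obtain ⟨a, b, ha, hb, rfl⟩ := exists_eq_vecMulVec_of_det_eq_zero hd hY0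
    rw [Matrix.mul_vecMulVec, Matrix.vecMulVec_mul] at hY
    refine hno _ _ (hUne a ha) (fun h0 => hb ?_) hY
    refine dotProduct_eq_zero_iff.1 fun y => ?_
    obtain ⟨x, rfl⟩ := hW y
    rw [Matrix.dotProduct_mulVec, h0, zero_dotProduct]
  -- Since `U * W` lies in the hull, `T` is closed under multiplication and `X ↦ U * X * W` sends it
  -- back into the hull.
  let T : Set (Matrix (Fin 2) (Fin 2) ℝ) := {X | ∃ A ∈ closedHull S, X = W * A * U}
  have hTmul : ∀ X ∈ T, ∀ Y ∈ T, X * Y ∈ T := by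
    rintro _ ⟨A, hA, rfl⟩ _ ⟨C, hC, rfl⟩
    exact ⟨A * (U * W) * C, mul_mem (mul_mem hA h) hC, by simp only [Matrix.mul_assoc]⟩
  have hTmem : ∀ X ∈ T, U * X * W ∈ closedHull S := by
    rintro _ ⟨A, hA, rfl⟩
    have := mul_mem (mul_mem h hA) h
    simpa only [Matrix.mul_assoc] using this
  obtain ⟨e, he, hTe⟩ := exists_common_eigenvector hTmul
    (fun X hX => hsing X (hTmem X hX)) fun X hX => by
      refine scalar_or_trace_eq_zero ?_ fun Y hY => hsing Y ?_
      · obtain ⟨A, hA, rfl⟩ := hX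
        have h1 := isPerron_closedHull hP _ (mul_mem h hA)
        rw [Matrix.mul_assoc] at h1
        exact h1.mul_comm
      · have hcl : IsClosed {Y : Matrix (Fin 2) (Fin 2) ℝ | U * Y * W ∈ closedHull S} :=
          isClosed_closedHull.preimage
            ((continuous_const.matrix_mul continuous_id).matrix_mul continuous_const)
        refine closure_minimal ?_ hcl hY
        rintro _ ⟨t, ht, n, hn, rfl⟩
        have hXn : X ^ n ∈ T :=
          pow_mem_of_pos (S := ⟨T, fun ha hb => hTmul _ ha _ hb⟩) hX hn
        have := smul_mem_closedHull (hTmem _ hXn) ht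
        simpa [Matrix.mul_smul, Matrix.smul_mul] using this
  have hspan := orbit_span_eq_top hirr hB hB0 (hUne e he)
  -- `W` sends the orbit of `U e`, which spans `ℝ^d`, into the line of the common eigenvector `e`;
  -- but `W` is onto `ℝ²`.
  have htop : (ℝ ∙ e) = ⊤ := by
    rw [← top_le_iff]
    have hle : (⊤ : Submodule ℝ (Fin d → ℝ)) ≤ (ℝ ∙ e).comap (Matrix.toLin' W) := by
      rw [← hspan, Submodule.span_le]
      rintro _ ⟨A, hA, rfl⟩
      obtain ⟨c, hc⟩ := hTe _ ⟨A, subset_closedHull hA, rfl⟩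
      refine Submodule.mem_span_singleton.2 ⟨c, ?_⟩
      rw [← hc]
      simp [Matrix.mul_assoc]
    intro y _
    obtain ⟨x, rfl⟩ := hW y
    exact hle (Submodule.mem_top : x ∈ _)
  have h1 := finrank_span_singleton (K := ℝ) he
  rw [htop, finrank_top, Module.finrank_fin_fun] at h1
  norm_num at h1

end PerronSemigroup

end

theorem theorem1 {d : ℕ} (S : Subsemigroup (Matrix (Fin d) (Fin d) ℝ))
    (hne : (S : Set (Matrix (Fin d) (Fin d) ℝ)).Nonempty)
    (hirr : PerronSemigroup.IsIrreducible S)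
    (hperron : PerronSemigroup.IsPerron S)
    (hindex : ¬ 3 ≤ PerronSemigroup.semigroupIndex S) :
    ∃ K : PointedCone ℝ (Fin d → ℝ),
      PerronSemigroup.IsProperCone K ∧ PerronSemigroup.IsInvariantCone S K := by
  open PerronSemigroup in
  by_cases hzero : ∀ A ∈ S, A = 0
  · exact exists_properCone_of_subset_zero hzero
  push Not at hzero
  obtain ⟨B, hB, hB0⟩ := hzero
  obtain ⟨A, hA, hAidx⟩ := Nat.sInf_mem (hne.image expansionIndex)
  have hlt : expansionIndex A < 3 := by
    rw [hAidx]
    exact not_le.1 hindex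
  obtain ⟨n, hn, hnle, U, W, hUW, hU, hW⟩ :=
    exists_factorization_mem_closedHull hA (hperron A hA) hB hB0
  obtain ⟨u, v, hu, hv, huv⟩ :
      ∃ u v : Fin d → ℝ, u ≠ 0 ∧ v ≠ 0 ∧ Matrix.vecMulVec u v ∈ closedHull S := by
    obtain rfl | rfl : n = 1 ∨ n = 2 := by omega
    · refine ⟨fun i => U i 0, W 0, fun h0 => ?_, fun h0 => ?_, ?_⟩
      · refine one_ne_zero (hU (a₁ := 1) (a₂ := 0) ?_)
        ext i
        simpa [Matrix.mulVec, dotProduct] using congrFun h0 i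
      · obtain ⟨x, hx⟩ := hW 1
        have := congrFun hx 0
        rw [Matrix.mulVec, h0, zero_dotProduct] at this
        exact zero_ne_one this
      · convert hUW using 1
        ext i j
        simp [Matrix.vecMulVec_apply, Matrix.mul_apply]
    · exact exists_vecMulVec_mem_of_factorization_two hirr hperron hB hB0 hUW hU hW
  exact exists_invariantCone_of_vecMulVec_mem hirr hperron hB hB0 hu hv huv
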